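/- A fully dynamic graph on an $n$-element vertex set $V$ is a sequence $G_0,G_1,\dots,G_M$ of graphs on $V$ in which $G_0$ has no edges and each $G_i$ ($i\ge1$) is obtained from $G_{i-1}$ by adding or deleting a single edge. Let $C\ge 1$ be an integer and assume black-box access to a static algorithm that, given a $C$-colorable graph on $V$ and a subset $S\subseteq V$, returns a proper $C$-coloring of the subgraph induced by $S$. A dynamic coloring algorithm with $k$ colors assigns, at every time $i$, a color from $\{1,\dots,k\}$ to every vertex, based only on $G_0,\dots,G_i$ and the black box (and, if it is randomized, on random bits); it may know $n$, $C$ and $\beta$, but neither $M$ nor future updates. The number of recolorings of an update is the number of vertices whose color changes. There are absolute constants hidden in the $O(\cdot)$ such that the following holds for every real $\beta$ with $1\le\beta\le\log_2 n$. (1) There is a deterministic dynamic algorithm using a palette of $O\!\left(\frac{C}{\beta}\log^3 n\right)$ colors such that, on every fully dynamic graph $G_0,\dots,G_M$ all of whose graphs are $C$-colorable, the coloring is proper at all times and the total number of recolorings during the $M$ updates is at most $O(\beta)\cdot M$ (that is, $O(\beta)$ amortized recolorings per update). (2) If $n\ge 3$, there is a randomized dynamic algorithm using a palette of $O\!\left(\frac{C}{\beta}\log^2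 n\,(\log\log n+\log\beta)\right)$ colors such that, on every fully dynamic graph $G_0,\dots,G_M$ that is fixed independently of the random bits (oblivious adversary) and all of whose graphs are $C$-colorable, the coloring is proper at all times for every outcome of the random bits and the expected total number of recolorings during the $M$ updates is at most $O(\beta)\cdot M$. -/

import Mathlib

open MeasureTheory

/-- `H` is obtained from `G` by adding or deleting a single edge. -/
def IsEdgeUpdate {V : Type} (G H : SimpleGraph V) : Prop :=
  ∃ u v : V, u ≠ v ∧
    ((¬ G.Adj u v ∧ H = G ⊔ SimpleGraph.edge u v) ∨
      (G.Adj u v ∧ H = G.deleteEdges {s(u, v)}))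

/-- `G 0, …, G M` is a fully dynamic graph with `M` updates: the initial graph has no edges, and
each further graph arises from the previous one by a single edge update. -/
def IsDynamicGraph {V : Type} (G : ℕ → SimpleGraph V) (M : ℕ) : Prop :=
  G 0 = ⊥ ∧ ∀ i < M, IsEdgeUpdate (G i) (G (i + 1))

/-- A black-box static algorithm: given a `C`-colorable graph on `n` vertices and a set `S` of
vertices, it returns a proper `C`-coloring of the subgraph induced by `S`. -/
def StaticColoring (n C : ℕ) : Type :=
  ∀ G : SimpleGraph (Fin n), G.Colorable C → ∀ S : Set (Fin n), (G.induce S).Coloring (Fin C)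

/-- The graphs `G 0, …, G i` seen up to and including time `i`. -/
def history {V : Type} (G : ℕ → SimpleGraph V) (i : ℕ) : List (SimpleGraph V) :=
  (List.range (i + 1)).map G

/-- A deterministic dynamic (online) algorithm with palette `Fin k` and access to a black-box
static algorithm: its current coloring is determined by the black box and by the graphs seen so
far. -/
def DynamicAlgorithm (n C k : ℕ) : Type :=
  StaticColoring n C → List (SimpleGraph (Fin n)) → Fin n → Fin k

/-- The coloring held at time `i` when the algorithm runs on the dynamic graph `G`. -/
def DynamicAlgorithm.coloring {n C k : ℕ} (alg : DynamicAlgorithm n C k)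
    (A : StaticColoring n C) (G : ℕ → SimpleGraph (Fin n)) (i : ℕ) : Fin n → Fin k :=
  alg A (history G i)

/-- At all times `0, …, M` no two adjacent vertices have the same color. -/
def DynamicAlgorithm.ProperUpTo {n C k : ℕ} (alg : DynamicAlgorithm n C k)
    (A : StaticColoring n C) (G : ℕ → SimpleGraph (Fin n)) (M : ℕ) : Prop :=
  ∀ i ≤ M, ∀ u v : Fin n, (G i).Adj u v → alg.coloring A G i u ≠ alg.coloring A G i v

/-- The total number of recolorings during the first `M` updates: for each update, the number of
vertices that change their color is counted. -/
def DynamicAlgorithm.recolorings {n C k : ℕ} (alg : DynamicAlgorithm n C k)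
    (A : StaticColoring n C) (G : ℕ → SimpleGraph (Fin n)) (M : ℕ) : ℕ :=
  ∑ i ∈ Finset.range M,
    (Finset.univ.filter fun v : Fin n =>
      alg.coloring A G (i + 1) v ≠ alg.coloring A G i v).card

/-- A randomized dynamic algorithm: a random choice of a deterministic one, such that the color
assignments it produces are random variables. -/
structure RandomizedDynamicAlgorithm (n C k : ℕ) where
  /-- the space of random seeds -/
  Ω : Type
  /-- the events -/
  [measurableSpace : MeasurableSpace Ω]
  /-- the law of the seed -/
  law : Measure Ω
  [isProbabilityMeasure : IsProbabilityMeasure law]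
  /-- the deterministic algorithm that is run on a given seed -/
  run : Ω → DynamicAlgorithm n C k
  measurable_run : ∀ (A : StaticColoring n C) (h : List (SimpleGraph (Fin n))),
    Measurable fun ω => run ω A h

attribute [instance] RandomizedDynamicAlgorithm.measurableSpace
  RandomizedDynamicAlgorithm.isProbabilityMeasure

/-- The expected total number of recolorings during the first `M` updates, for a dynamic graph
that is fixed independently of the seed (oblivious adversary). -/
noncomputable def RandomizedDynamicAlgorithm.expectedRecolorings {n C k : ℕ}
    (alg : RandomizedDynamicAlgorithm n C k) (A : StaticColoring n C)
    (G : ℕ → SimpleGraph (Fin n)) (M : ℕ) : ENNReal :=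
  ∫⁻ ω, ((alg.run ω).recolorings A G M : ENNReal) ∂alg.law

/-!
Both parts follow from one deterministic algorithm, which uses only `O((C / β) log² n)` colors and
makes `O(β)` amortized recolorings. Since `log n ≥ log 2` and `log log n ≥ log log 3 > 0`, this
palette is within both of the claimed bounds, and part (2) holds with a one-point seed space.

The color of a vertex is a triple: a level in `{0, …, L}` with `n ≤ 2 ^ L`, a static color in
`Fin C`, and a correction in `Fin d`. The first two entries form its *class*, and the *load* of a
vertex is its number of neighbors in its own class. When a level is rebuilt, the black box is run
on all its vertices, so that their loads become `0`; later edge insertions inside a class are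
handled by the corrections. As long as all loads are less than `d`, an inserted monochromatic edge
is repaired by giving one endpoint a correction that none of its neighbors in its class has
(`exists_free`). If an insertion raises a load to `d`, the overloaded vertex is taken out of its
level and joins a rebuild of all levels `≤ j` into level `j`, where `j` is least such that the
rebuilt set `S_j` has at most `2 ^ j` vertices.

At most about every `d / 2`-th update can produce an overload, because the sum of the loads grows by at
most `2` with each update and drops by `d - 1` when an overloaded vertex is taken out. The cost of
a rebuild is at most `2 ^ j`, and by minimality of `j` more than `2 ^ (j - 1)` of the vertices
concerned strictly rise in level, so it is paid by the sum of the levels, which an overload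
decreases by at most `L + 1` otherwise (`card_rebuildSet_le`). An overload therefore costs `O(L)`
amortized, and an update `O(1 + L / d)` (`step_invariant`). The choice `d ≈ L / β` gives `O(β)`
recolorings per update with `(L + 1) * C * d = O(C L² / β)` colors.
-/

namespace LevelColoring

open Classical

/-! ### The algorithm -/

/-- A color: a level in `{0, …, L}` and a static color, which together form the class of a vertex,
and a correction in `Fin d`. -/
abbrev Color (L C d : ℕ) : Type := (Fin (L + 1) × Fin C) × Fin d

variable {n C L d : ℕ}

/-- The load of `u`: the number of its neighbors in its own class. -/
noncomputable def load (G : SimpleGraph (Fin n)) (s : Fin n → Color L C d) (u : Fin n) : ℕ :=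
  (Finset.univ.filter fun w => G.Adj u w ∧ (s w).1 = (s u).1).card

/-- The vertices affected when the overloaded vertex `u` triggers a rebuild of level `j`: `u` and
all vertices at levels at most `j`. -/
noncomputable def rebuildSet (s : Fin n → Color L C d) (u : Fin n) (j : ℕ) : Finset (Fin n) :=
  Finset.univ.filter fun v => v = u ∨ ((s v).1.1 : ℕ) ≤ j

/-- The level that is rebuilt when `u` is overloaded: the least `j` for which the rebuilt set has
at most `2 ^ j` vertices. The cap at `L` is never active when `n ≤ 2 ^ L`. -/
noncomputable def rebuildLevel (s : Fin n → Color L C d) (u : Fin n) : ℕ :=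
  sInf {j | j = L ∨ (rebuildSet s u j).card ≤ 2 ^ j}

theorem rebuildLevel_le (s : Fin n → Color L C d) (u : Fin n) : rebuildLevel s u ≤ L :=
  Nat.sInf_le (Or.inl rfl)

/-- Rebuild with overloaded vertex `u`: the affected vertices move to the rebuilt level, are colored
by the black box and lose their corrections. -/
noncomputable def rebuild [NeZero d] (A : StaticColoring n C) (G : SimpleGraph (Fin n))
    (hG : G.Colorable C) (s : Fin n → Color L C d) (u : Fin n) : Fin n → Color L C d :=
  fun v =>
    if hv : v ∈ {w | w ∈ rebuildSet s u (rebuildLevel s u)} then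
      ((⟨rebuildLevel s u, Nat.lt_succ_of_le (rebuildLevel_le s u)⟩, A G hG _ ⟨v, hv⟩), 0)
    else s v

theorem exists_free {G : SimpleGraph (Fin n)} {s : Fin n → Color L C d} {u : Fin n}
    (h : load G s u < d) :
    ∃ x : Fin d, ∀ w, G.Adj u w → (s w).1 = (s u).1 → (s w).2 ≠ x := by
  by_contra! hx
  have hsub : (Finset.univ : Finset (Fin d)) ⊆
      (Finset.univ.filter fun w => G.Adj u w ∧ (s w).1 = (s u).1).image fun w => (s w).2 := by
    intro x _
    obtain ⟨w, h1, h2, h3⟩ := hx x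
    exact Finset.mem_image.2 ⟨w, by simp [h1, h2], h3⟩
  have h1 := (Finset.card_le_card hsub).trans Finset.card_image_le
  rw [Finset.card_univ, Fintype.card_fin] at h1
  exact absurd h (not_lt.2 h1)

/-- The reaction to a new graph `G`: a rebuild if some vertex is overloaded, otherwise a new
correction for an endpoint of a monochromatic edge if there is one. -/
noncomputable def step [NeZero d] (A : StaticColoring n C) (s : Fin n → Color L C d)
    (G : SimpleGraph (Fin n)) : Fin n → Color L C d :=
  if hG : G.Colorable C then
    if h : ∃ u, d ≤ load G s u then rebuild A G hG s h.choose
    else if h' : ∃ a b, G.Adj a b ∧ s a = s b then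
      Function.update s h'.choose
        ((s h'.choose).1,
          (exists_free (not_le.1 (not_exists.1 h h'.choose))).choose)
    else s
  else s

/-- All vertices at the top level, with equal colors. -/
def initial (n C L d : ℕ) [NeZero C] [NeZero d] : Fin n → Color L C d :=
  fun _ => ((Fin.last L, 0), 0)

/-- The coloring held after a sequence of graphs has been seen. -/
noncomputable def state [NeZero C] [NeZero d] (L : ℕ) (A : StaticColoring n C)
    (l : List (SimpleGraph (Fin n))) : Fin n → Color L C d :=
  l.foldl (step A) (initial n C L d)

/-! ### Rebuilding a level -/

/-- The rebuilt set is at most twice as large as the set of its vertices that strictly rise in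
level, where `u` counts as rising. -/
theorem card_rebuildSet_le (hn : n ≤ 2 ^ L) (s : Fin n → Color L C d) (u : Fin n) :
    (rebuildSet s u (rebuildLevel s u)).card ≤
      2 * (Finset.univ.filter fun v => v = u ∨ ((s v).1.1 : ℕ) < rebuildLevel s u).card := by
  have hmem : rebuildLevel s u = L ∨
      (rebuildSet s u (rebuildLevel s u)).card ≤ 2 ^ rebuildLevel s u :=
    Nat.sInf_mem (s := {j | j = L ∨ (rebuildSet s u j).card ≤ 2 ^ j}) ⟨L, Or.inl rfl⟩
  have hle : (rebuildSet s u (rebuildLevel s u)).card ≤ 2 ^ rebuildLevel s u := by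
    rcases hmem with h | h
    · rw [h]
      exact (Finset.card_le_univ _).trans (by simpa using hn)
    · exact h
  rcases hj : rebuildLevel s u with _ | j
  · rw [hj] at hle
    have : 0 < (Finset.univ.filter fun v => v = u ∨ ((s v).1.1 : ℕ) < 0).card :=
      Finset.card_pos.2 ⟨u, by simp⟩
    rw [pow_zero] at hle
    omega
  · have hlt := Nat.notMem_of_lt_sInf (s := {j | j = L ∨ (rebuildSet s u j).card ≤ 2 ^ j})
      (m := j) (by change j < rebuildLevel s u; omega)
    have hlt' : 2 ^ j < (rebuildSet s u j).card := by
      by_contra h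
      exact hlt (Or.inr (not_lt.1 h))
    rw [hj, pow_succ] at hle
    have heq : (Finset.univ.filter fun v => v = u ∨ ((s v).1.1 : ℕ) < j + 1) =
        rebuildSet s u j := by
      simp only [rebuildSet, Nat.lt_succ_iff]
    rw [heq]
    omega

/-- Total level of all vertices. -/
def levelSum (s : Fin n → Color L C d) : ℕ := ∑ v, ((s v).1.1 : ℕ)

/-- The number of vertices on which two colorings differ. -/
noncomputable def changes {α : Type} (s t : Fin n → α) : ℕ :=
  (Finset.univ.filter fun v => t v ≠ s v).card

theorem mem_rebuildSet_self (s : Fin n → Color L C d) (u : Fin n) (j : ℕ) : u ∈ rebuildSet s u j := by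
  simp [rebuildSet]

theorem level_lt_of_notMem {s : Fin n → Color L C d} {u v : Fin n}
    (hv : v ∉ rebuildSet s u (rebuildLevel s u)) :
    rebuildLevel s u < ((s v).1.1 : ℕ) := by
  simp only [rebuildSet, Finset.mem_filter, Finset.mem_univ, true_and, not_or, not_le] at hv
  exact hv.2

section Rebuild

variable [NeZero d] {A : StaticColoring n C} {G : SimpleGraph (Fin n)} {hG : G.Colorable C}
  {s : Fin n → Color L C d} {u : Fin n}

theorem level_rebuild_of_mem {v : Fin n} (hv : v ∈ rebuildSet s u (rebuildLevel s u)) :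
    ((rebuild A G hG s u v).1.1 : ℕ) = rebuildLevel s u := by
  simp [rebuild, hv]

theorem rebuild_of_notMem {v : Fin n} (hv : v ∉ rebuildSet s u (rebuildLevel s u)) :
    rebuild A G hG s u v = s v := by
  simp [rebuild, hv]

/-- After a rebuild, adjacent vertices of the same class both lie outside of the rebuilt set. -/
theorem notMem_of_class_eq {v w : Fin n} (hvw : G.Adj v w)
    (h : (rebuild A G hG s u v).1 = (rebuild A G hG s u w).1) :
    v ∉ rebuildSet s u (rebuildLevel s u) ∧ w ∉ rebuildSet s u (rebuildLevel s u) := by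
  have hl : ((rebuild A G hG s u v).1.1 : ℕ) = ((rebuild A G hG s u w).1.1 : ℕ) := by rw [h]
  by_cases hv : v ∈ rebuildSet s u (rebuildLevel s u) <;>
    by_cases hw : w ∈ rebuildSet s u (rebuildLevel s u)
  · have h2 := congrArg Prod.snd h
    simp only [rebuild, Set.mem_ofPred_eq, hv, hw, dite_true] at h2
    exact absurd h2 ((A G hG _).valid (by simpa using hvw))
  · rw [level_rebuild_of_mem hv, rebuild_of_notMem hw] at hl
    have := level_lt_of_notMem hw
    omega
  · rw [level_rebuild_of_mem hw, rebuild_of_notMem hv] at hl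
    have := level_lt_of_notMem hv
    omega
  · exact ⟨hv, hw⟩

/-- The recolorings of a rebuild are paid by the increase of the total level, up to the
`L + 1` levels that the overloaded vertex may lose. -/
theorem changes_rebuild_le (hn : n ≤ 2 ^ L) :
    changes s (rebuild A G hG s u) + 2 * levelSum s ≤
      2 * levelSum (rebuild A G hG s u) + 2 * (L + 1) := by
  have h1 : changes s (rebuild A G hG s u) ≤ (rebuildSet s u (rebuildLevel s u)).card := by
    refine Finset.card_le_card fun v hv => ?_
    by_contra h
    simp [rebuild_of_notMem h] at hv
  have h2 := card_rebuildSet_le hn s u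
  have h3 : levelSum s +
      (Finset.univ.filter fun v => v = u ∨ ((s v).1.1 : ℕ) < rebuildLevel s u).card ≤
      levelSum (rebuild A G hG s u) + (L + 1) := by
    have hu : (∑ v : Fin n, if v = u then L + 1 else 0) = L + 1 := by simp
    refine le_of_le_of_eq ?_ (congrArg _ hu)
    rw [levelSum, levelSum, Finset.card_filter, ← Finset.sum_add_distrib,
      ← Finset.sum_add_distrib]
    refine Finset.sum_le_sum fun v _ => ?_
    have hL := (s v).1.1.is_lt
    by_cases hvu : v = u
    · simp only [hvu, true_or, if_true] at hL ⊢
      omega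
    · by_cases hv : v ∈ rebuildSet s u (rebuildLevel s u)
      · rw [level_rebuild_of_mem hv]
        have hv' : ((s v).1.1 : ℕ) ≤ rebuildLevel s u := by
          simpa [rebuildSet, hvu] using hv
        simp only [hvu, false_or, if_false]
        split_ifs <;> omega
      · rw [rebuild_of_notMem hv]
        have := level_lt_of_notMem hv
        simp only [hvu, false_or, if_false]
        split_ifs <;> omega
  omega

end Rebuild

/-! ### One update -/

/-- The invariant: no vertex is overloaded and the coloring is proper. -/
def Good (G : SimpleGraph (Fin n)) (s : Fin n → Color L C d) : Prop :=
  (∀ u, load G s u < d) ∧ ∀ a b, G.Adj a b → s a ≠ s b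

/-- The sum of all loads. -/
noncomputable def loadSum (G : SimpleGraph (Fin n)) (s : Fin n → Color L C d) : ℕ :=
  ∑ u, load G s u

theorem exists_adj_imp_of_isEdgeUpdate {V : Type} {G H : SimpleGraph V} (h : IsEdgeUpdate G H) :
    ∃ u v : V, u ≠ v ∧
      ∀ a b, H.Adj a b → G.Adj a b ∨ (a = u ∧ b = v) ∨ (a = v ∧ b = u) := by
  obtain ⟨u, v, huv, ⟨-, rfl⟩ | ⟨-, rfl⟩⟩ := h
  · refine ⟨u, v, huv, fun a b hab => ?_⟩
    rw [SimpleGraph.sup_adj, SimpleGraph.edge_adj] at hab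
    tauto
  · refine ⟨u, v, huv, fun a b hab => ?_⟩
    rw [SimpleGraph.deleteEdges_adj] at hab
    exact Or.inl hab.1

theorem load_le_of_edge {G H : SimpleGraph (Fin n)} {u v : Fin n} (huv : u ≠ v)
    (hGH : ∀ a b, H.Adj a b → G.Adj a b ∨ (a = u ∧ b = v) ∨ (a = v ∧ b = u))
    (s : Fin n → Color L C d) (w : Fin n) :
    load H s w ≤ load G s w + ((if w = u then 1 else 0) + (if w = v then 1 else 0)) := by
  -- the only possible new neighbor of `w`
  have key : ∀ x, (∀ b, H.Adj w b → G.Adj w b ∨ b = x) → load H s w ≤ load G s w + 1 := by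
    intro x hx
    refine (Finset.card_le_card fun b hb => ?_).trans (Finset.card_insert_le x _)
    simp only [Finset.mem_insert, Finset.mem_filter, Finset.mem_univ, true_and] at hb ⊢
    have := hx b hb.1
    tauto
  by_cases hu : w = u
  · have := key v fun b hb => by
      rcases hGH _ _ hb with h | h | h
      · exact Or.inl h
      · exact Or.inr h.2
      · exact absurd (hu.symm.trans h.1) huv
    simp only [hu, if_true] at this ⊢
    omega
  · by_cases hv : w = v
    · have := key u fun b hb => by
        rcases hGH _ _ hb with h | h | h
        · exact Or.inl h
        · exact absurd h.1 hu
        · exact Or.inr h.2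
      simp only [hv, if_true] at this ⊢
      omega
    · simp only [hu, hv, if_false, add_zero]
      refine Finset.card_le_card fun b hb => ?_
      simp only [Finset.mem_filter, Finset.mem_univ, true_and] at hb ⊢
      have := hGH _ _ hb.1
      tauto

/-- A rebuild triggered by an overloaded endpoint `x` of the new edge restores the invariant and
lowers the sum of the loads by `d - 1`. -/
theorem rebuild_good [NeZero d] {A : StaticColoring n C} {G H : SimpleGraph (Fin n)}
    (hH : H.Colorable C) {s : Fin n → Color L C d} (hs : Good G s) {x : Fin n}
    (hx : d ≤ load G s x + 1)
    (hGH : ∀ a b, H.Adj a b → G.Adj a b ∨ a = x ∨ b = x) :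
    Good H (rebuild A H hH s x) ∧ loadSum H (rebuild A H hH s x) + d ≤ loadSum G s + 1 := by
  have hadj : ∀ a b, H.Adj a b →
      (rebuild A H hH s x a).1 = (rebuild A H hH s x b).1 →
        G.Adj a b ∧ rebuild A H hH s x a = s a ∧ rebuild A H hH s x b = s b ∧ a ≠ x := by
    intro a b hab hc
    obtain ⟨ha, hb⟩ := notMem_of_class_eq hab hc
    have hax : a ≠ x := fun h => ha (h ▸ mem_rebuildSet_self _ _ _)
    have hbx : b ≠ x := fun h => hb (h ▸ mem_rebuildSet_self _ _ _)
    have := hGH a b hab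
    exact ⟨by tauto, rebuild_of_notMem ha, rebuild_of_notMem hb, hax⟩
  have hload : ∀ w, load H (rebuild A H hH s x) w + (if w = x then load G s x else 0) ≤
      load G s w := by
    intro w
    by_cases hw : w = x
    · have h0 : load H (rebuild A H hH s x) w = 0 := by
        rw [load, Finset.card_eq_zero, Finset.filter_eq_empty_iff]
        rintro b - ⟨h1, h2⟩
        exact (hadj w b h1 h2.symm).2.2.2 hw
      rw [h0, if_pos hw, hw, zero_add]
    · simp only [hw, if_false, add_zero]
      refine Finset.card_le_card fun b hb => ?_
      simp only [Finset.mem_filter, Finset.mem_univ, true_and] at hb ⊢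
      obtain ⟨h1, h2, h3, -⟩ := hadj w b hb.1 hb.2.symm
      exact ⟨h1, by rw [← h2, ← h3]; exact hb.2⟩
  refine ⟨⟨fun w => ?_, fun a b hab hc => ?_⟩, ?_⟩
  · exact lt_of_le_of_lt ((Nat.le_add_right _ _).trans (hload w)) (hs.1 w)
  · obtain ⟨h1, h2, h3, -⟩ := hadj a b hab (by rw [hc])
    exact hs.2 a b h1 (by rw [← h2, ← h3]; exact hc)
  · have hsum := Finset.sum_le_sum fun w (_ : w ∈ Finset.univ) => hload w
    rw [Finset.sum_add_distrib] at hsum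
    simp only [Finset.sum_ite_eq', Finset.mem_univ, if_true] at hsum
    change loadSum H (rebuild A H hH s x) + load G s x ≤ loadSum G s at hsum
    omega

theorem load_congr (G : SimpleGraph (Fin n)) {s t : Fin n → Color L C d}
    (h : ∀ v, (t v).1 = (s v).1) (u : Fin n) : load G t u = load G s u := by
  simp only [load, h]

theorem step_of_good [NeZero d] (A : StaticColoring n C) {G : SimpleGraph (Fin n)}
    {s : Fin n → Color L C d} (hs : Good G s) : step A s G = s := by
  have h1 : ¬ ∃ u, d ≤ load G s u := by
    rintro ⟨u, hu⟩
    exact absurd (hs.1 u) (not_lt.2 hu)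
  have h2 : ¬ ∃ a b, G.Adj a b ∧ s a = s b := by
    rintro ⟨a, b, h, h'⟩
    exact hs.2 a b h h'
  simp only [step, h1, h2, dite_false]
  split_ifs <;> rfl

/-- A single update preserves the invariant, and its recolorings are paid for by a fixed amount
and the change of the potential
`2 * d * levelSum - 2 * (L + 1) * loadSum` (everything scaled by `d`). -/
theorem step_invariant [NeZero d] (hn : n ≤ 2 ^ L) (A : StaticColoring n C)
    {G H : SimpleGraph (Fin n)} (hGH : IsEdgeUpdate G H) (hH : H.Colorable C)
    {s : Fin n → Color L C d} (hs : Good G s) :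
    Good H (step A s H) ∧
      d * changes s (step A s H) + 2 * (L + 1) * loadSum H (step A s H) + 2 * d * levelSum s ≤
        (d + 4 * (L + 1)) + 2 * (L + 1) * loadSum G s + 2 * d * levelSum (step A s H) := by
  obtain ⟨u, v, huv, hadj⟩ := exists_adj_imp_of_isEdgeUpdate hGH
  have hload := load_le_of_edge huv hadj s
  by_cases h : ∃ x, d ≤ load H s x
  · have hx : d ≤ load H s h.choose := h.choose_spec
    have hstep : step A s H = rebuild A H hH s h.choose := by
      simp only [step, hH, h, dite_true]
    rw [hstep]
    generalize h.choose = x at hx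
    have hlx := hload x
    have hsx := hs.1 x
    -- only the endpoints of a new edge can become overloaded
    have hxuv : x = u ∨ x = v := by
      by_contra! hne
      simp only [hne.1, hne.2, if_false] at hlx
      omega
    have hx1 : d ≤ load G s x + 1 := by
      rcases hxuv with rfl | rfl
      · simp only [huv, if_true, if_false] at hlx
        omega
      · simp only [huv.symm, if_true, if_false] at hlx
        omega
    obtain ⟨hgood, hsum⟩ := rebuild_good (A := A) hH hs hx1 fun a b hab => by
      rcases hadj a b hab with h | ⟨rfl, rfl⟩ | ⟨rfl, rfl⟩
      · exact Or.inl h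
      · rcases hxuv with h | h <;> simp [h]
      · rcases hxuv with h | h <;> simp [h]
    refine ⟨hgood, ?_⟩
    have hch := changes_rebuild_le (A := A) (hG := hH) (s := s) (u := x) hn
    have e1 := Nat.mul_le_mul_left d hch
    have e2 := Nat.mul_le_mul_left (2 * (L + 1)) hsum
    nlinarith
  · have hlt : ∀ x, load H s x < d := fun x => not_le.1 (not_exists.1 h x)
    have hsum : loadSum H s ≤ loadSum G s + 2 := by
      have := Finset.sum_le_sum fun w (_ : w ∈ Finset.univ) => hload w
      rw [Finset.sum_add_distrib, Finset.sum_add_distrib] at this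
      simpa [loadSum, add_assoc] using this
    -- classes are kept and at most one correction changes
    suffices hsuf : Good H (step A s H) ∧ (∀ w, (step A s H w).1 = (s w).1) ∧
        changes s (step A s H) ≤ 1 by
      obtain ⟨h1, h2, h3⟩ := hsuf
      refine ⟨h1, ?_⟩
      have e1 : loadSum H (step A s H) = loadSum H s :=
        Finset.sum_congr rfl fun w _ => load_congr H h2 w
      have e2 : levelSum (step A s H) = levelSum s :=
        Finset.sum_congr rfl fun w _ => by rw [h2]
      rw [e1, e2]
      have e3 := Nat.mul_le_mul_left d h3
      have e4 := Nat.mul_le_mul_left (2 * (L + 1)) hsum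
      nlinarith
    by_cases h' : ∃ a b, H.Adj a b ∧ s a = s b
    · obtain ⟨b, hab, hsab⟩ := h'.choose_spec
      have hfree := (exists_free (hlt h'.choose)).choose_spec
      have hstep : step A s H = Function.update s h'.choose
          ((s h'.choose).1, (exists_free (hlt h'.choose)).choose) := by
        simp only [step, hH, h, h', dite_true, dite_false]
      rw [hstep]
      generalize (exists_free (hlt h'.choose)).choose = x at hfree
      generalize h'.choose = a at *
      have hcl : ∀ w, (Function.update s a ((s a).1, x) w).1 = (s w).1 := by
        intro w
        by_cases hw : w = a
        · subst hw
          simp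
        · simp [hw]
      refine ⟨⟨fun w => by rw [load_congr H hcl]; exact hlt w, ?_⟩, hcl, ?_⟩
      · intro w w' hww hc
        by_cases hw : w = a
        · subst hw
          have hw' : w' ≠ w := hww.ne'
          rw [Function.update_self, Function.update_of_ne hw'] at hc
          exact hfree w' hww (by rw [← hc]) (by rw [← hc])
        · by_cases hw' : w' = a
          · subst hw'
            rw [Function.update_self, Function.update_of_ne hw] at hc
            exact hfree w hww.symm (by rw [hc]) (by rw [hc])
          · rw [Function.update_of_ne hw, Function.update_of_ne hw'] at hc
            -- both `s(a, b)` and `s(w, w')` would be the new edge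
            have hab' : ¬ G.Adj a b := fun h => hs.2 _ _ h hsab
            have hww' : ¬ G.Adj w w' := fun h => hs.2 _ _ h hc
            have h1 := hadj a b hab
            have h2 := hadj w w' hww
            grind
      · refine (Finset.card_le_card (t := {a}) fun w hw => ?_).trans (by simp)
        by_contra hne
        rw [Finset.mem_singleton] at hne
        simp [hne] at hw
    · have hg : Good H s := ⟨hlt, fun a b hab hc => h' ⟨a, b, hab, hc⟩⟩
      rw [step_of_good A hg]
      exact ⟨hg, fun _ => rfl, by simp [changes]⟩

/-! ### The whole sequence of updates -/

theorem history_succ {V : Type} (G : ℕ → SimpleGraph V) (i : ℕ) :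
    history G (i + 1) = history G i ++ [G (i + 1)] := by
  simp [history, List.range_succ]

theorem state_succ [NeZero C] [NeZero d] (A : StaticColoring n C) (G : ℕ → SimpleGraph (Fin n))
    (i : ℕ) : state (d := d) L A (history G (i + 1)) =
      step A (state L A (history G i)) (G (i + 1)) := by
  rw [history_succ, state, List.foldl_append]
  rfl

theorem good_bot [NeZero d] {s : Fin n → Color L C d} : Good ⊥ s :=
  ⟨fun u => by simpa [load] using NeZero.pos d, fun a b h => by simp at h⟩

theorem state_zero [NeZero C] [NeZero d] (A : StaticColoring n C) {G : ℕ → SimpleGraph (Fin n)}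
    (hG : G 0 = ⊥) : state (d := d) L A (history G 0) = initial n C L d := by
  have : history G 0 = [⊥] := by simp [history, hG]
  rw [this]
  exact step_of_good A good_bot

theorem levelSum_le (s : Fin n → Color L C d) : levelSum s ≤ n * L := by
  refine (Finset.sum_le_card_nsmul _ _ L fun v _ => ?_).trans (by simp)
  exact Nat.lt_succ_iff.1 (s v).1.1.is_lt

theorem state_invariant [NeZero C] [NeZero d] (hn : n ≤ 2 ^ L) (A : StaticColoring n C)
    {G : ℕ → SimpleGraph (Fin n)} {M : ℕ} (hG : IsDynamicGraph G M)
    (hC : ∀ i ≤ M, (G i).Colorable C) (i : ℕ) (hi : i ≤ M) :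
    Good (G i) (state (d := d) L A (history G i)) ∧
      d * (∑ t ∈ Finset.range i, changes (state (d := d) L A (history G t))
          (state L A (history G (t + 1)))) +
        2 * (L + 1) * loadSum (G i) (state (d := d) L A (history G i)) + 2 * d * (n * L) ≤
      (d + 4 * (L + 1)) * i + 2 * d * levelSum (state (d := d) L A (history G i)) := by
  induction i with
  | zero =>
    rw [state_zero A hG.1, hG.1]
    refine ⟨good_bot, ?_⟩
    simp [levelSum, initial, loadSum, load]
  | succ i ih =>
    obtain ⟨h1, h2⟩ := ih (by omega)
    obtain ⟨h3, h4⟩ := step_invariant hn A (hG.2 i (by omega)) (hC (i + 1) hi) h1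
    rw [← state_succ] at h3 h4
    refine ⟨h3, ?_⟩
    rw [Finset.sum_range_succ]
    linarith

theorem exists_dynamicAlgorithm (n C L d : ℕ) (hC : 1 ≤ C) (hd : 1 ≤ d) (hn : n ≤ 2 ^ L) :
    ∃ alg : DynamicAlgorithm n C ((L + 1) * C * d),
      ∀ (A : StaticColoring n C) (G : ℕ → SimpleGraph (Fin n)) (M : ℕ),
        IsDynamicGraph G M → (∀ i ≤ M, (G i).Colorable C) →
          alg.ProperUpTo A G M ∧ d * alg.recolorings A G M ≤ (d + 4 * (L + 1)) * M := by
  have : NeZero C := ⟨by omega⟩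
  have : NeZero d := ⟨by omega⟩
  let e : Color L C d ≃ Fin ((L + 1) * C * d) :=
    (Equiv.prodCongr finProdFinEquiv (Equiv.refl _)).trans finProdFinEquiv
  refine ⟨fun A l v => e (state L A l v), fun A G M hG hcol => ⟨?_, ?_⟩⟩
  · intro i hi u v huv h
    exact (state_invariant hn A hG hcol i hi).1.2 u v huv (e.injective h)
  · have h := (state_invariant (d := d) hn A hG hcol M le_rfl).2
    have hl := Nat.mul_le_mul_left (2 * d) (levelSum_le (state (d := d) L A (history G M)))
    have heq : DynamicAlgorithm.recolorings (fun A l v => e (state L A l v)) A G M =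
        ∑ t ∈ Finset.range M, changes (state (d := d) L A (history G t))
          (state L A (history G (t + 1))) := by
      refine Finset.sum_congr rfl fun t _ => ?_
      unfold changes
      congr 1
      ext v
      simp [DynamicAlgorithm.coloring]
    rw [heq]
    omega

/-! ### Choice of the parameters -/

/-- The deterministic algorithm with `O((C / β) log² n)` colors, from which both parts follow. -/
theorem exists_dynamicAlgorithm_of_le_logb (n C : ℕ) (β : ℝ) (hC : 1 ≤ C) (hβ : 1 ≤ β)
    (hβn : β ≤ Real.logb 2 n) :
    2 ≤ n ∧ ∃ k : ℕ, (k : ℝ) ≤ 40 * ((C / β) * Real.log n ^ 2) ∧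
      ∃ alg : DynamicAlgorithm n C k,
        ∀ (A : StaticColoring n C) (G : ℕ → SimpleGraph (Fin n)) (M : ℕ),
          IsDynamicGraph G M → (∀ i ≤ M, (G i).Colorable C) →
            alg.ProperUpTo A G M ∧ (alg.recolorings A G M : ℝ) ≤ 5 * β * M := by
  have hn : 2 ≤ n := by
    by_contra! h
    have : n = 0 ∨ n = 1 := by omega
    rcases this with rfl | rfl <;> norm_num at hβn <;> linarith
  refine ⟨hn, ?_⟩
  set L := Nat.clog 2 n with hL
  have hnL : n ≤ 2 ^ L := Nat.le_pow_clog (by norm_num) n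
  have hβ0 : 0 < β := by linarith
  have hn0 : (0 : ℝ) < n := by positivity
  have hlogL : Real.logb 2 n ≤ L := by
    rw [Real.logb_le_iff_le_rpow (by norm_num) hn0, Real.rpow_natCast]
    exact_mod_cast hnL
  have hLlog : (L : ℝ) ≤ Real.logb 2 n + 1 := by
    have h1 : 2 ^ (L - 1) < n := Nat.pow_pred_clog_lt_self (by norm_num) (by omega)
    have h2 : 1 ≤ L := Nat.clog_pos (by norm_num) hn
    have h3 : ((L - 1 : ℕ) : ℝ) ≤ Real.logb 2 n := by
      rw [Real.le_logb_iff_rpow_le (by norm_num) hn0, Real.rpow_natCast]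
      exact_mod_cast h1.le
    rw [Nat.cast_sub h2] at h3
    push_cast at h3
    linarith
  set d := ⌈((L : ℝ) + 1) / β⌉₊ with hd
  have hd1 : ((L : ℝ) + 1) / β ≤ d := Nat.le_ceil _
  have hd2 : (d : ℝ) < ((L : ℝ) + 1) / β + 1 := Nat.ceil_lt_add_one (by positivity)
  have hd3 : (1 : ℝ) ≤ ((L : ℝ) + 1) / β := by
    rw [le_div_iff₀ hβ0]
    linarith
  have hdpos : 1 ≤ d := by
    have : (1 : ℝ) ≤ d := hd3.trans hd1
    exact_mod_cast this
  obtain ⟨alg, halg⟩ := exists_dynamicAlgorithm n C L d hC hdpos hnL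
  refine ⟨_, ?_, alg, fun A G M hG hcol => ⟨(halg A G M hG hcol).1, ?_⟩⟩
  · have hlog2 : 0.69 < Real.log 2 := by linarith [Real.log_two_gt_d9]
    have hL3 : (L : ℝ) + 1 ≤ 3 * Real.logb 2 n := by linarith
    have hsq : ((L : ℝ) + 1) ^ 2 ≤ 20 * Real.log n ^ 2 := by
      have h0 : Real.logb 2 n * Real.log 2 = Real.log n := by
        rw [Real.logb, div_mul_cancel₀ _ (by linarith)]
      have h1 : 0.69 * Real.logb 2 n ≤ Real.log n := by nlinarith
      nlinarith
    have hC0 : (0 : ℝ) ≤ C := by positivity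
    push_cast
    calc ((L : ℝ) + 1) * C * d ≤ ((L : ℝ) + 1) * C * (2 * (((L : ℝ) + 1) / β)) := by
          gcongr
          linarith
      _ = 2 * (C / β) * ((L : ℝ) + 1) ^ 2 := by ring
      _ ≤ 2 * (C / β) * (20 * Real.log n ^ 2) := by gcongr
      _ = 40 * ((C / β) * Real.log n ^ 2) := by ring
  · have h : (d : ℝ) * alg.recolorings A G M ≤ (d + 4 * (L + 1)) * M := by
      exact_mod_cast (halg A G M hG hcol).2
    have hd0 : (0 : ℝ) < d := by positivity
    have hLd : (L : ℝ) + 1 ≤ d * β := by rwa [div_le_iff₀ hβ0] at hd1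
    refine le_of_mul_le_mul_left (h.trans ?_) hd0
    have hdβ : (d : ℝ) ≤ d * β := le_mul_of_one_le_right hd0.le hβ
    calc ((d : ℝ) + 4 * (L + 1)) * M ≤ (d * β + 4 * (d * β)) * M := by gcongr
      _ = d * (5 * β * M) := by ring

/-- A deterministic algorithm as a randomized one with a one-point seed space. -/
noncomputable def toRandomized {k : ℕ} (alg : DynamicAlgorithm n C k) :
    RandomizedDynamicAlgorithm n C k where
  Ω := Unit
  law := Measure.dirac ()
  run _ := alg
  measurable_run _ _ := measurable_const

end LevelColoring

theorem theorem1 :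
    (∃ K : ℝ, 0 < K ∧
      ∀ (n C : ℕ) (β : ℝ), 1 ≤ C → 1 ≤ β → β ≤ Real.logb 2 n →
        ∃ k : ℕ, (k : ℝ) ≤ K * ((C / β) * Real.log n ^ 3) ∧
          ∃ alg : DynamicAlgorithm n C k,
            ∀ (A : StaticColoring n C) (G : ℕ → SimpleGraph (Fin n)) (M : ℕ),
              IsDynamicGraph G M → (∀ i ≤ M, (G i).Colorable C) →
                alg.ProperUpTo A G M ∧
                (alg.recolorings A G M : ℝ) ≤ K * β * M) ∧
    (∃ K : ℝ, 0 < K ∧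
      ∀ (n C : ℕ) (β : ℝ), 3 ≤ n → 1 ≤ C → 1 ≤ β → β ≤ Real.logb 2 n →
        ∃ k : ℕ,
          (k : ℝ) ≤ K * ((C / β) * Real.log n ^ 2 * (Real.log (Real.log n) + Real.log β)) ∧
          ∃ alg : RandomizedDynamicAlgorithm n C k,
            ∀ (A : StaticColoring n C) (G : ℕ → SimpleGraph (Fin n)) (M : ℕ),
              IsDynamicGraph G M → (∀ i ≤ M, (G i).Colorable C) →
                (∀ ω : alg.Ω, (alg.run ω).ProperUpTo A G M) ∧
                alg.expectedRecolorings A G M ≤ ENNReal.ofReal (K * β * M)) := by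
  refine ⟨⟨80, by norm_num, fun n C β hC hβ hβn => ?_⟩, ?_⟩
  · obtain ⟨hn, k, hk, alg, halg⟩ := LevelColoring.exists_dynamicAlgorithm_of_le_logb n C β hC hβ hβn
    refine ⟨k, hk.trans ?_, alg, fun A G M hG hcol => ?_⟩
    · have hlog : 0.5 ≤ Real.log n := by
        have := Real.log_le_log (by norm_num : (0 : ℝ) < 2) (by exact_mod_cast hn : (2 : ℝ) ≤ n)
        linarith [Real.log_two_gt_d9]
      have h0 : 0 ≤ (C / β) * Real.log n ^ 2 := by positivity
      have := mul_le_mul_of_nonneg_left hlog h0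
      linarith
    · obtain ⟨h1, h2⟩ := halg A G M hG hcol
      refine ⟨h1, h2.trans ?_⟩
      gcongr
      norm_num
  · have hlog3 : 1 < Real.log 3 := by
      rw [Real.lt_log_iff_exp_lt (by norm_num)]
      exact Real.exp_one_lt_three
    have hc : 0 < Real.log (Real.log 3) := Real.log_pos hlog3
    refine ⟨40 / Real.log (Real.log 3) + 5, by positivity, fun n C β hn hC hβ hβn => ?_⟩
    obtain ⟨-, k, hk, alg, halg⟩ := LevelColoring.exists_dynamicAlgorithm_of_le_logb n C β hC hβ hβn
    refine ⟨k, hk.trans ?_, LevelColoring.toRandomized alg, fun A G M hG hcol => ?_⟩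
    · have hloglog : Real.log (Real.log 3) ≤ Real.log (Real.log n) + Real.log β := by
        have h1 : Real.log 3 ≤ Real.log n :=
          Real.log_le_log (by norm_num) (by exact_mod_cast hn)
        have h2 := Real.log_le_log (by linarith) h1
        linarith [Real.log_nonneg hβ]
      have h0 : 0 ≤ (C / β) * Real.log n ^ 2 := by positivity
      calc 40 * ((C / β) * Real.log n ^ 2)
          = 40 / Real.log (Real.log 3) * ((C / β) * Real.log n ^ 2 * Real.log (Real.log 3)) := by
            field_simp
        _ ≤ (40 / Real.log (Real.log 3) + 5) *
            ((C / β) * Real.log n ^ 2 * (Real.log (Real.log n) + Real.log β)) := by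
            gcongr
            linarith
    · obtain ⟨h1, h2⟩ := halg A G M hG hcol
      refine ⟨fun _ => h1, ?_⟩
      have he : (LevelColoring.toRandomized alg).expectedRecolorings A G M =
          ((alg.recolorings A G M : ℕ) : ENNReal) :=
        lintegral_dirac' (f := fun _ : Unit => ((alg.recolorings A G M : ℕ) : ENNReal)) ()
          measurable_const
      rw [he, ← ENNReal.ofReal_natCast]
      refine ENNReal.ofReal_le_ofReal (h2.trans ?_)
      gcongr
      have : 0 < 40 / Real.log (Real.log 3) := by positivity
      linarith
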